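/- Let $M$ be a smooth $n$-dimensional manifold and let $\varphi : M \to \mathbf{R}^{n+1}$ be a parabolic affine sphere with affine normal $\xi$, induced connection $\nabla$ and Blaschke metric $g$. That is: $\varphi$ is a smooth immersion and $\xi$ is a smooth transversal vector field along $\varphi$; $\nabla$ and $g$ are determined by $\partial_X(\varphi_*Y) = \varphi_*(\nabla_X Y) + g(X,Y)\,\xi$; $g$ is nondegenerate (of any signature); the induced volume form $\theta = \det(\xi, \varphi_*\cdot, \dots, \varphi_*\cdot)$ is $\nabla$-parallel and is the metric volume form of $g$, i.e. $|\theta(X_1,\dots,X_n)| = |\det(g(X_i,X_j))|^{1/2}$; and the shape tensor $S$, defined by $\partial_X \xi = -\varphi_*(SX) + \tau(X)\,\xi$ with a one-form $\tau$, vanishes. **Theorem 3.6.** The parabolic sphere $\varphi$ arises as Blaschke immersion of a special Kähler manifold if and only if it is special. Precisely, the following are equivalent. 1. There is an almost complex structure $J$ on $M$ such that $(M, J, \nabla, g)$ is an (affine) special Kähler manifold: $J$ is a complex structure (it comes from an atlas of holomorphic charts), $g$ is $J$-Hermitian, the Kähler form $g(\cdot, J\cdot)$ is closed, $\nabla$ is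 torsionfree and flat, $\nabla\big(g(\cdot,J\cdot)\big) = 0$, and $d^\nabla J = 0$, where $d^\nabla J(X,Y) = (\nabla_X J)Y - (\nabla_Y J)X$. 2. There is an almost complex structure $J$ on $M$ such that $g$ is $J$-Hermitian, i.e. $g(JX,JY) = g(X,Y)$, and the two-form $\omega := g(J\cdot,\cdot)$ is $\nabla$-parallel. -/

import Mathlib

open Bundle VectorField
open scoped Manifold ContDiff

noncomputable section

namespace AffineSphere

variable {n : ℕ} {M : Type*} [TopologicalSpace M] [ChartedSpace (EuclideanSpace ℝ (Fin n)) M]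

/-! ### Tensors on a smooth manifold -/

/-- A pseudo-Riemannian metric: a smooth field of nondegenerate symmetric bilinear forms on the
tangent spaces, of arbitrary signature. -/
structure PseudoRiemannianMetric (n : ℕ) (M : Type*) [TopologicalSpace M]
    [ChartedSpace (EuclideanSpace ℝ (Fin n)) M] [IsManifold (𝓡 n) ∞ M] where
  /-- The bilinear form on each tangent space. -/
  val (x : M) : TangentSpace (𝓡 n) x →L[ℝ] TangentSpace (𝓡 n) x →L[ℝ] ℝ
  symm (x : M) (v w : TangentSpace (𝓡 n) x) : val x v w = val x w v
  nondegenerate (x : M) (v : TangentSpace (𝓡 n) x) (hv : ∀ w, val x v w = 0) : v = 0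
  contMDiff : ContMDiff (𝓡 n)
    ((𝓡 n).prod 𝓘(ℝ, EuclideanSpace ℝ (Fin n) →L[ℝ] EuclideanSpace ℝ (Fin n) →L[ℝ] ℝ)) ∞
    (fun x ↦ TotalSpace.mk' (EuclideanSpace ℝ (Fin n) →L[ℝ] EuclideanSpace ℝ (Fin n) →L[ℝ] ℝ)
      (E := fun x : M ↦ TangentSpace (𝓡 n) x →L[ℝ] TangentSpace (𝓡 n) x →L[ℝ] ℝ) x (val x))

/-- An almost complex structure: a smooth field of endomorphisms `J` of the tangent spaces
with `J ^ 2 = -1`. -/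
structure AlmostComplexStructure (n : ℕ) (M : Type*) [TopologicalSpace M]
    [ChartedSpace (EuclideanSpace ℝ (Fin n)) M] [IsManifold (𝓡 n) ∞ M] where
  /-- The endomorphism of each tangent space. -/
  val (x : M) : TangentSpace (𝓡 n) x →L[ℝ] TangentSpace (𝓡 n) x
  sq_eq_neg (x : M) (v : TangentSpace (𝓡 n) x) : val x (val x v) = -v
  contMDiff : ContMDiff (𝓡 n)
    ((𝓡 n).prod 𝓘(ℝ, EuclideanSpace ℝ (Fin n) →L[ℝ] EuclideanSpace ℝ (Fin n))) ∞
    (fun x ↦ TotalSpace.mk' (EuclideanSpace ℝ (Fin n) →L[ℝ] EuclideanSpace ℝ (Fin n))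
      (E := fun x : M ↦ TangentSpace (𝓡 n) x →L[ℝ] TangentSpace (𝓡 n) x) x (val x))

/-- An affine connection, i.e. a covariant derivative on the tangent bundle of `M`. In Mathlib's
convention, `D Y x (X x)` is the value of `∇_X Y` at `x`. -/
abbrev AffineConnection (n : ℕ) (M : Type*) [TopologicalSpace M]
    [ChartedSpace (EuclideanSpace ℝ (Fin n)) M] [IsManifold (𝓡 n) ∞ M] :=
  CovariantDerivative (𝓡 n) (EuclideanSpace ℝ (Fin n)) (TangentSpace (𝓡 n) : M → Type _)

variable [IsManifold (𝓡 n) ∞ M]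

/-- `X` is a smooth vector field on `M`. -/
def IsSmoothField (X : Π x : M, TangentSpace (𝓡 n) x) : Prop :=
  ContMDiff (𝓡 n) (𝓡 n).tangent ∞ (fun x ↦ (⟨x, X x⟩ : TangentBundle (𝓡 n) M))

/-- The vector field `X` is differentiable at the point `x`. -/
def DiffFieldAt (X : Π x : M, TangentSpace (𝓡 n) x) (x : M) : Prop :=
  MDifferentiableAt (𝓡 n) (𝓡 n).tangent (fun y ↦ (⟨y, X y⟩ : TangentBundle (𝓡 n) M)) x

/-- The curvature `R(X, Y) Z = ∇_X ∇_Y Z - ∇_Y ∇_X Z - ∇_[X,Y] Z` vanishes. -/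
def IsFlat (D : AffineConnection n M) : Prop :=
  ∀ X Y Z : Π x : M, TangentSpace (𝓡 n) x, IsSmoothField X → IsSmoothField Y → IsSmoothField Z →
    ∀ x, D (fun y ↦ D Z y (Y y)) x (X x) - D (fun y ↦ D Z y (X y)) x (Y x)
      - D Z x (mlieBracket (𝓡 n) X Y x) = 0

/-- A field `B` of bilinear forms is `∇`-parallel:
`X (B(Y, Z)) = B(∇_X Y, Z) + B(Y, ∇_X Z)`. -/
def IsParallelBilin (D : AffineConnection n M)
    (B : Π x : M, TangentSpace (𝓡 n) x → TangentSpace (𝓡 n) x → ℝ) : Prop :=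
  ∀ (x : M) (v : TangentSpace (𝓡 n) x) (Y Z : Π x : M, TangentSpace (𝓡 n) x),
    DiffFieldAt Y x → DiffFieldAt Z x →
    mvfderiv (𝓡 n) (fun y ↦ B y (Y y) (Z y)) x v = B x (D Y x v) (Z x) + B x (Y x) (D Z x v)

/-- A field `ν` of forms of degree `n` is `∇`-parallel:
`X (ν(Y₁, …, Yₙ)) = ∑ i, ν(Y₁, …, ∇_X Yᵢ, …, Yₙ)`. -/
def IsParallelVolume (D : AffineConnection n M)
    (ν : Π x : M, (Fin n → TangentSpace (𝓡 n) x) → ℝ) : Prop :=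
  ∀ (x : M) (v : TangentSpace (𝓡 n) x) (Y : Fin n → Π x : M, TangentSpace (𝓡 n) x),
    (∀ i, DiffFieldAt (Y i) x) →
    mvfderiv (𝓡 n) (fun y ↦ ν y (fun i ↦ Y i y)) x v
      = ∑ i, ν x (Function.update (fun j ↦ Y j x) i (D (Y i) x v))

/-! ### Hypersurface immersions with a transversal field -/

/-- The volume form `θ = det(ξ, φ_* ·, …, φ_* ·)` induced on `M` by `φ` and the field `ξ`. -/
def inducedVolume (φ ξ : M → Fin (n + 1) → ℝ) (x : M) (w : Fin n → TangentSpace (𝓡 n) x) : ℝ :=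
  Matrix.det (Matrix.of (Fin.cons (ξ x) (fun i ↦ mvfderiv (𝓡 n) φ x (w i)) :
    Fin (n + 1) → Fin (n + 1) → ℝ))

/-- `ν` takes the value `± √|det g(wᵢ, wⱼ)|` on every `n`-tuple of tangent vectors. For a
volume form `ν` this says that `ν` is the metric volume form of `g` for the orientation
given by `ν`. -/
def IsMetricVolume (g : PseudoRiemannianMetric n M)
    (ν : Π x : M, (Fin n → TangentSpace (𝓡 n) x) → ℝ) : Prop :=
  ∀ (x : M) (w : Fin n → TangentSpace (𝓡 n) x),
    |ν x w| = √|Matrix.det (Matrix.of fun i j ↦ g.val x (w i) (w j))|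

/-- `φ` is a smooth immersion of the `n`-dimensional manifold `M` into affine `(n+1)`-space and
`ξ` is a smooth transversal vector field along `φ`. -/
structure IsTransversalImmersion (φ ξ : M → Fin (n + 1) → ℝ) : Prop where
  contMDiff : ContMDiff (𝓡 n) 𝓘(ℝ, Fin (n + 1) → ℝ) ∞ φ
  injective_mvfderiv : ∀ x, Function.Injective (mvfderiv (𝓡 n) φ x)
  contMDiff_field : ContMDiff (𝓡 n) 𝓘(ℝ, Fin (n + 1) → ℝ) ∞ ξ
  transversal : ∀ x, ξ x ∉ Set.range (mvfderiv (𝓡 n) φ x)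

/-- The Gauss formula `∂_X (φ_* Y) = φ_* (∇_X Y) + g(X, Y) ξ`. For a transversal field `ξ`, it
determines the induced connection `∇` and the induced bilinear form `g`. -/
def GaussFormula (φ ξ : M → Fin (n + 1) → ℝ) (D : AffineConnection n M)
    (g : PseudoRiemannianMetric n M) : Prop :=
  ∀ (x : M) (v : TangentSpace (𝓡 n) x) (Y : Π x : M, TangentSpace (𝓡 n) x), DiffFieldAt Y x →
    mvfderiv (𝓡 n) (fun y ↦ mvfderiv (𝓡 n) φ y (Y y)) x v
      = mvfderiv (𝓡 n) φ x (D Y x v) + g.val x v (Y x) • ξ x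

/-- `S` is the shape tensor: `∂_X ξ = - φ_* (S X) + τ(X) ξ` for some one-form `τ`. -/
def IsShapeTensor (φ ξ : M → Fin (n + 1) → ℝ)
    (S : Π x : M, TangentSpace (𝓡 n) x →L[ℝ] TangentSpace (𝓡 n) x) : Prop :=
  ∃ τ : Π x : M, TangentSpace (𝓡 n) x →L[ℝ] ℝ, ∀ (x : M) (v : TangentSpace (𝓡 n) x),
    mvfderiv (𝓡 n) ξ x v = - mvfderiv (𝓡 n) φ x (S x v) + τ x v • ξ x

/-- `φ` with affine normal `ξ` is a Blaschke immersion with induced connection `D` and Blaschke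
metric `g`: the metric volume form of `g` coincides with the induced volume form and is
parallel. -/
structure IsBlaschkeImmersion (φ ξ : M → Fin (n + 1) → ℝ) (D : AffineConnection n M)
    (g : PseudoRiemannianMetric n M) : Prop where
  transversal_immersion : IsTransversalImmersion φ ξ
  gauss : GaussFormula φ ξ D g
  metric_volume : IsMetricVolume g (inducedVolume φ ξ)
  parallel_volume : IsParallelVolume D (inducedVolume φ ξ)

/-- An affine hypersphere: a Blaschke immersion whose shape tensor is `c • id`. -/
structure IsAffineSphere (c : ℝ) (φ ξ : M → Fin (n + 1) → ℝ) (D : AffineConnection n M)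
    (g : PseudoRiemannianMetric n M) : Prop where
  blaschke : IsBlaschkeImmersion φ ξ D g
  shape : IsShapeTensor φ ξ (fun x ↦ c • ContinuousLinearMap.id ℝ (TangentSpace (𝓡 n) x))

/-- A parabolic (or improper) affine sphere: an affine hypersphere with vanishing shape tensor. -/
def IsParabolicSphere (φ ξ : M → Fin (n + 1) → ℝ) (D : AffineConnection n M)
    (g : PseudoRiemannianMetric n M) : Prop :=
  IsAffineSphere 0 φ ξ D g

/-! ### Special Kähler manifolds and special parabolic spheres -/

/-- `g` is Hermitian with respect to `J`. -/
def IsHermitian (g : PseudoRiemannianMetric n M) (J : AlmostComplexStructure n M) : Prop :=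
  ∀ (x : M) (v w : TangentSpace (𝓡 n) x), g.val x (J.val x v) (J.val x w) = g.val x v w

/-- `J` is (the almost complex structure of) a complex structure: `M` is covered by smooth
charts with values in `ℂ ^ m` whose differentials intertwine `J` with multiplication by `i`.
The coordinate changes between such charts are then holomorphic. -/
def IsComplexStructure (J : AlmostComplexStructure n M) : Prop :=
  ∃ m : ℕ, ∀ x₀ : M, ∃ z : OpenPartialHomeomorph M (EuclideanSpace ℂ (Fin m)),
    x₀ ∈ z.source ∧
    ContMDiffOn (𝓡 n) 𝓘(ℝ, EuclideanSpace ℂ (Fin m)) ∞ z z.source ∧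
    ContMDiffOn 𝓘(ℝ, EuclideanSpace ℂ (Fin m)) (𝓡 n) ∞ z.symm z.target ∧
    ∀ x ∈ z.source, ∀ v : TangentSpace (𝓡 n) x,
      mvfderiv (𝓡 n) z x (J.val x v) = Complex.I • mvfderiv (𝓡 n) z x v

/-- A two-form `Ω` is closed: `dΩ(X, Y, Z) = 0`, with `dΩ` given by the invariant formula. -/
def IsClosedTwoForm (Ω : Π x : M, TangentSpace (𝓡 n) x → TangentSpace (𝓡 n) x → ℝ) : Prop :=
  ∀ X Y Z : Π x : M, TangentSpace (𝓡 n) x, IsSmoothField X → IsSmoothField Y → IsSmoothField Z →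
    ∀ x, mvfderiv (𝓡 n) (fun y ↦ Ω y (Y y) (Z y)) x (X x)
      - mvfderiv (𝓡 n) (fun y ↦ Ω y (X y) (Z y)) x (Y x)
      + mvfderiv (𝓡 n) (fun y ↦ Ω y (X y) (Y y)) x (Z x)
      - Ω x (mlieBracket (𝓡 n) X Y x) (Z x)
      + Ω x (mlieBracket (𝓡 n) X Z x) (Y x)
      - Ω x (mlieBracket (𝓡 n) Y Z x) (X x) = 0

/-- The Kähler form `ω = g(·, J ·)`. -/
def kahlerForm (g : PseudoRiemannianMetric n M) (J : AlmostComplexStructure n M) (x : M)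
    (v w : TangentSpace (𝓡 n) x) : ℝ :=
  g.val x v (J.val x w)

/-- `(M, J, g)` is a Kähler manifold, the metric being possibly indefinite. -/
structure IsKahler (g : PseudoRiemannianMetric n M) (J : AlmostComplexStructure n M) : Prop where
  complex : IsComplexStructure J
  hermitian : IsHermitian g J
  closed : IsClosedTwoForm (kahlerForm g J)

/-- `d^∇ J = 0`, where `d^∇ J (X, Y) = (∇_X J) Y - (∇_Y J) X` and
`(∇_X J) Y = ∇_X (J Y) - J ∇_X Y`. -/
def IsCovariantlyClosed (D : AffineConnection n M) (J : AlmostComplexStructure n M) : Prop :=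
  ∀ (x : M) (X Y : Π x : M, TangentSpace (𝓡 n) x), DiffFieldAt X x → DiffFieldAt Y x →
    (D (fun y ↦ J.val y (Y y)) x (X x) - J.val x (D Y x (X x)))
      - (D (fun y ↦ J.val y (X y)) x (Y x) - J.val x (D X x (Y x))) = 0

/-- `(M, J, ∇, g)` is an (affine) special Kähler manifold. -/
structure IsSpecialKahler (D : AffineConnection n M) (g : PseudoRiemannianMetric n M)
    (J : AlmostComplexStructure n M) : Prop where
  kahler : IsKahler g J
  torsion_free : D.torsion = 0
  flat : IsFlat D
  parallel : IsParallelBilin D (kahlerForm g J)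
  covariantly_closed : IsCovariantlyClosed D J

/-- `(M, ∇, g)` is special: there is an almost complex structure `J` for which `g` is
Hermitian and such that the two-form `g(J ·, ·)` is `∇`-parallel. -/
def IsSpecial (D : AffineConnection n M) (g : PseudoRiemannianMetric n M) : Prop :=
  ∃ J : AlmostComplexStructure n M, IsHermitian g J ∧
    IsParallelBilin D (fun x v w ↦ g.val x (J.val x v) w)

end AffineSphere

end

open scoped Topology

noncomputable section

namespace AffineSphere

/-! One implication is pointwise: for Hermitian `g`, the forms `g(·, J·)` and `g(J·, ·)` differ only
by sign, so they are parallel together (`isParallelBilin_kahlerForm_iff`).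

For the other, the affine normal `ξ` of a parabolic sphere is locally constant: `S = 0` leaves `∂ξ =
τ ξ`, and parallelism of `θ` forces `τ = 0`. Composing `φ` with a projection along `ξ` gives
coordinates `u` in which `∇` is ordinary differentiation, hence flat and torsion-free; composing it
with a functional equal to 1 on `ξ` gives a function `f` with `g = ∇df` (`exists_isFlatChart`).

If `ω = g(J·, ·)` is parallel, its components in the coordinates `u` are constants. For a coordinate
field `∂ᵢ`, `ω(Jv, ∂ᵢ) = -g(v, ∂ᵢ) = -d(∂ᵢf)(v)`. Inverting the constant matrix of `ω` therefore
yields `q` with `dq = du ∘ J` (`exists_primitive`). This carries the rest. Read through `du`, `d^∇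
J` is `d(du ∘ J) = ddq = 0`. With `J₀ = J(x₀)`, the map `ζ = u - J₀ q` satisfies `dζ ∘ J = J₀ ∘ dζ`
and has invertible differential at `x₀`, so it is a holomorphic chart. Finally, a parallel two-form
is closed because `∇` has no torsion. -/

theorem two_le_infty : (2 : ℕ∞ω) ≤ ∞ :=
  show ((2 : ℕ∞) : ℕ∞ω) ≤ ((⊤ : ℕ∞) : ℕ∞ω) from WithTop.coe_le_coe.2 le_top

/-! ### Derivatives of vector-valued functions on a manifold -/

section Calculus

variable {n : ℕ} {M : Type*} [TopologicalSpace M] [ChartedSpace (EuclideanSpace ℝ (Fin n)) M]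
  {F F' : Type*} [NormedAddCommGroup F] [NormedSpace ℝ F] [NormedAddCommGroup F'] [NormedSpace ℝ F']

theorem mvfderiv_congr {f f' : M → F} {x : M} (h : f =ᶠ[𝓝 x] f') (v : TangentSpace (𝓡 n) x) :
    mvfderiv (𝓡 n) f x v = mvfderiv (𝓡 n) f' x v := by
  change mfderiv (𝓡 n) 𝓘(ℝ, F) f x v = mfderiv (𝓡 n) 𝓘(ℝ, F) f' x v
  rw [h.mfderiv_eq]
  rfl

theorem mvfderiv_comp_eq_fderiv {g : F → F'} {f : M → F} {x : M} (hg : DifferentiableAt ℝ g (f x))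
    (hf : MDifferentiableAt (𝓡 n) 𝓘(ℝ, F) f x) (v : TangentSpace (𝓡 n) x) :
    mvfderiv (𝓡 n) (fun y ↦ g (f y)) x v = fderiv ℝ g (f x) (mvfderiv (𝓡 n) f x v) := by
  have h := mfderiv_comp_apply (I := 𝓡 n) (I' := 𝓘(ℝ, F)) (I'' := 𝓘(ℝ, F')) x
    hg.mdifferentiableAt hf v
  rw [mfderiv_eq_fderiv] at h
  exact h

theorem mvfderiv_clm_comp (L : F →L[ℝ] F') {f : M → F} {x : M}
    (hf : MDifferentiableAt (𝓡 n) 𝓘(ℝ, F) f x) (v : TangentSpace (𝓡 n) x) :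
    mvfderiv (𝓡 n) (fun y ↦ L (f y)) x v = L (mvfderiv (𝓡 n) f x v) := by
  rw [mvfderiv_comp_eq_fderiv L.differentiableAt hf, L.fderiv]

theorem mvfderiv_fun_const (c : F) (x : M) (v : TangentSpace (𝓡 n) x) :
    mvfderiv (𝓡 n) (fun _ : M ↦ c) x v = 0 := by
  rw [mvfderiv_const]; rfl

variable [IsManifold (𝓡 n) ∞ M]

theorem contMDiffAt_mvfderiv_apply {h : M → F} (hh : ContMDiff (𝓡 n) 𝓘(ℝ, F) ∞ h) {x : M}
    {Y : Π x : M, TangentSpace (𝓡 n) x}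
    (hY : ContMDiffAt (𝓡 n) (𝓡 n).tangent ∞ (fun y ↦ (⟨y, Y y⟩ : TangentBundle (𝓡 n) M)) x) :
    ContMDiffAt (𝓡 n) 𝓘(ℝ, F) ∞ (fun y ↦ mvfderiv (𝓡 n) h y (Y y)) x := by
  have : IsManifold (𝓡 n) 1 M := .of_le (n := ∞) (by simp)
  have h1 := hh.contMDiff_tangentMap (m := ∞) (by simp)
  have h2 := contMDiff_snd_tangentBundle_modelSpace (𝕜 := ℝ) (n := ∞) F 𝓘(ℝ, F)
  exact (h2.comp h1).contMDiffAt.comp x hY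

theorem mdifferentiableAt_mvfderiv_apply {h : M → F} (hh : ContMDiff (𝓡 n) 𝓘(ℝ, F) ∞ h) {x : M}
    {Y : Π x : M, TangentSpace (𝓡 n) x} (hY : DiffFieldAt Y x) :
    MDifferentiableAt (𝓡 n) 𝓘(ℝ, F) (fun y ↦ mvfderiv (𝓡 n) h y (Y y)) x := by
  have : IsManifold (𝓡 n) 1 M := .of_le (n := ∞) (by simp)
  have h1 := hh.contMDiff_tangentMap (m := ∞) (by simp)
  have h2 := contMDiff_snd_tangentBundle_modelSpace (𝕜 := ℝ) (n := ∞) F 𝓘(ℝ, F)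
  exact ((h2.comp h1).contMDiffAt.mdifferentiableAt (by simp)).comp x hY

/-- The derivative along the Lie bracket is the commutator of derivatives. -/
theorem mvfderiv_apply_mlieBracket {h : M → F} {x : M} (hh : ContMDiffAt (𝓡 n) 𝓘(ℝ, F) ∞ h x)
    {V W : Π x : M, TangentSpace (𝓡 n) x} (hV : DiffFieldAt V x) (hW : DiffFieldAt W x) :
    mvfderiv (𝓡 n) h x (mlieBracket (𝓡 n) V W x) =
      mvfderiv (𝓡 n) (fun y ↦ mvfderiv (𝓡 n) h y (W y)) x (V x)
        - mvfderiv (𝓡 n) (fun y ↦ mvfderiv (𝓡 n) h y (V y)) x (W x) := by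
  have i1 : IsManifold (𝓡 n) 1 M := .of_le (n := ∞) (by simp)
  have i2 : IsManifold (𝓡 n) 2 M := .of_le (n := ∞) two_le_infty
  let E := EuclideanSpace ℝ (Fin n)
  let c := extChartAt (𝓡 n) x
  let H : E → F := h ∘ c.symm
  -- `P X` is the expression of `X` in the chart; the claim becomes the same identity on `E`, where
  -- it is the symmetry of the second derivative of `H`.
  let P (X : Π x : M, TangentSpace (𝓡 n) x) : E → E :=
    mpullbackWithin 𝓘(ℝ, E) (𝓡 n) c.symm X (Set.range (𝓡 n))
  have hH : ContDiffAt ℝ 2 H (c x) := by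
    have := (contMDiffAt_iff.1 hh).2
    simp only [extChartAt_model_space_eq_id, PartialEquiv.refl_coe, Function.id_comp,
      ModelWithCorners.range_eq_univ, contDiffWithinAt_univ] at this
    exact this.of_le two_le_infty
  have hP {X : Π x : M, TangentSpace (𝓡 n) x} (hX : DiffFieldAt X x) :
      DifferentiableAt ℝ (P X) (c x) := by
    have := MDifferentiableWithinAt.differentiableWithinAt_mpullbackWithin_vectorField
      (s := Set.univ) (mdifferentiableWithinAt_univ.2 hX)
    simp only [Set.preimage_univ, ModelWithCorners.range_eq_univ, Set.univ_inter] at this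
    simp only [P, ModelWithCorners.range_eq_univ]
    exact differentiableWithinAt_univ.1 this
  have hcP (X : Π x : M, TangentSpace (𝓡 n) x) :
      ∀ᶠ y in 𝓝 x, mfderiv (𝓡 n) 𝓘(ℝ, E) c y (X y) = P X (c y) := by
    have := eventuallyEq_mpullback_mpullbackWithin_extChartAt (I := 𝓡 n) (s := Set.univ) (x := x) X
    rw [nhdsWithin_univ] at this
    filter_upwards [this, extChartAt_source_mem_nhds (I := 𝓡 n) x] with y hy hyc
    rw [hy, mpullback_apply]
    exact (isInvertible_mfderiv_extChartAt hyc).self_apply_inverse _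
  have hHd : ∀ᶠ y in 𝓝 x, DifferentiableAt ℝ H (c y) :=
    (continuousAt_extChartAt (I := 𝓡 n) x).eventually
      ((hH.eventually (by simp)).mono fun e he ↦ he.differentiableAt (by simp))
  have hcd : ∀ᶠ y in 𝓝 x, MDifferentiableAt (𝓡 n) 𝓘(ℝ, E) c y := by
    filter_upwards [(chartAt E x).open_source.mem_nhds (mem_chart_source E x)] with y hy
    exact mdifferentiableAt_extChartAt hy
  have hdh : ∀ᶠ y in 𝓝 x, ∀ v, mvfderiv (𝓡 n) h y v
      = fderiv ℝ H (c y) (mfderiv (𝓡 n) 𝓘(ℝ, E) c y v) := by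
    filter_upwards [hHd, hcd, eventually_eventually_nhds.2 (extChartAt_source_mem_nhds (I := 𝓡 n) x)]
      with y h1 h2 h3 v
    rw [mvfderiv_congr (f' := fun y ↦ H (c y)) _ v, mvfderiv_comp_eq_fderiv h1 h2]
    · rfl
    · filter_upwards [h3] with z hz
      simp only [H, Function.comp]
      rw [c.left_inv hz]
  have hdX (X Y : Π x : M, TangentSpace (𝓡 n) x) (hX : DiffFieldAt X x) :
      mvfderiv (𝓡 n) (fun y ↦ mvfderiv (𝓡 n) h y (X y)) x (Y x)
        = fderiv ℝ (fun e ↦ fderiv ℝ H e (P X e)) (c x) (P Y (c x)) := by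
    rw [mvfderiv_congr (f' := fun y ↦ (fun e ↦ fderiv ℝ H e (P X e)) (c y)),
      mvfderiv_comp_eq_fderiv (g := fun e ↦ fderiv ℝ H e (P X e)), ← (hcP Y).self_of_nhds]
    · rfl
    · exact ((hH.fderiv_right (m := 1) (by norm_num)).differentiableAt (by simp)).clm_apply (hP hX)
    · exact hcd.self_of_nhds
    · filter_upwards [hdh, hcP X] with y h1 h2
      rw [h1, h2]
  rw [hdX W V hW, hdX V W hV, hdh.self_of_nhds,
    ← fderiv_apply_lieBracket hH (by simp) (hP hW) (hP hV)]
  congr 1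
  rw [← mlieBracketWithin_univ, mlieBracketWithin_apply]
  simp only [Set.preimage_univ, ModelWithCorners.range_eq_univ, Set.univ_inter]
  -- The bracket on `M` is the pullback of the bracket in the chart, so the differential of the
  -- chart cancels.
  refine ((isInvertible_mfderiv_extChartAt (mem_extChartAt_source x)).self_apply_inverse _).trans ?_
  simp only [P, ModelWithCorners.range_eq_univ]
  exact congrFun (lieBracketWithin_univ (𝕜 := ℝ) (E := E)) _

end Calculus

/-! ### Local coordinates -/

section Coordinates

variable (n : ℕ) {M : Type*} [TopologicalSpace M] [ChartedSpace (EuclideanSpace ℝ (Fin n)) M]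
  {F G : Type*} [NormedAddCommGroup F] [NormedSpace ℝ F]
  [NormedAddCommGroup G] [NormedSpace ℝ G]

/-- A smooth coordinate system with values in a vector space and preconnected range. -/
structure IsSmoothChart (z : OpenPartialHomeomorph M F) : Prop where
  contMDiffOn : ContMDiffOn (𝓡 n) 𝓘(ℝ, F) ∞ z z.source
  contMDiffOn_symm : ContMDiffOn 𝓘(ℝ, F) (𝓡 n) ∞ z.symm z.target
  isPreconnected : IsPreconnected z.target

variable {n}

/-- The inverse function theorem for vector-valued functions on a manifold. -/
theorem exists_isSmoothChart [IsManifold (𝓡 n) ∞ M] {h : M → F} {U : Set M} (hU : IsOpen U) {x : M} (hx : x ∈ U)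
    (hh : ContMDiffOn (𝓡 n) 𝓘(ℝ, F) ∞ h U) (e : EuclideanSpace ℝ (Fin n) ≃L[ℝ] F)
    (he : ∀ v : EuclideanSpace ℝ (Fin n), mvfderiv (𝓡 n) h x v = e v) :
    ∃ z : OpenPartialHomeomorph M F, x ∈ z.source ∧ z.source ⊆ U ∧ Set.EqOn z h z.source ∧
      IsSmoothChart n z := by
  let E := EuclideanSpace ℝ (Fin n)
  have : CompleteSpace F := by
    rw [← completeSpace_congr (e := e.toEquiv) e.isUniformEmbedding]; infer_instance
  let c := chartAt E x
  let H : E → F := h ∘ c.symm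
  let T : Set E := c.target ∩ c.symm ⁻¹' U
  have hT : IsOpen T := c.isOpen_inter_preimage_symm hU
  have hcx : c x ∈ T := ⟨mem_chart_target _ x, by simpa [c] using hx⟩
  have hHT : ContDiffOn ℝ ∞ H T := by
    rw [← contMDiffOn_iff_contDiffOn]
    exact hh.comp ((contMDiffOn_chart_symm (I := 𝓡 n)).mono Set.inter_subset_left)
      Set.inter_subset_right
  have hHa {a : E} (ha : a ∈ T) : ContDiffAt ℝ ∞ H a := hHT.contDiffAt (hT.mem_nhds ha)
  have hHd : HasFDerivAt H (e : E →L[ℝ] F) (c x) := by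
    have h1 := ((hh.contMDiffAt (hU.mem_nhds hx)).mdifferentiableAt (by simp)).hasMFDerivAt.2
    simp only [ModelWithCorners.range_eq_univ] at h1
    have h2 : HasFDerivAt H (mvfderiv (𝓡 n) h x : E →L[ℝ] F) (c x) :=
      hasFDerivWithinAt_univ.1 h1
    rwa [show (mvfderiv (𝓡 n) h x : E →L[ℝ] F) = (e : E →L[ℝ] F) from
      ContinuousLinearMap.ext (f := (mvfderiv (𝓡 n) h x : E →L[ℝ] F)) he] at h2
  let p := (hHa hcx).toOpenPartialHomeomorph H hHd (by simp)
  -- Invertibility of the derivative at every point, not only at `c x`, makes the inverse smooth on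
  -- its whole domain.
  let T' : Set E := T ∩ (fderiv ℝ H) ⁻¹' (Set.range ((↑) : (E ≃L[ℝ] F) → E →L[ℝ] F))
  have hT' : IsOpen T' :=
    (hHT.continuousOn_fderiv_of_isOpen hT (by simp)).isOpen_inter_preimage hT
      ContinuousLinearEquiv.isOpen
  have hcx' : c x ∈ T' := ⟨hcx, e, hHd.fderiv.symm⟩
  let p₁ := p.restrOpen T' hT'
  have hp₁ : c x ∈ p₁.source := ⟨(hHa hcx).mem_toOpenPartialHomeomorph_source hHd (by simp), hcx'⟩
  -- Shrinking the target to a ball makes it preconnected.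
  obtain ⟨ε, hε, hball⟩ := Metric.isOpen_iff.1 p₁.open_target _ (p₁.map_source hp₁)
  let p₂ := (p₁.symm.restrOpen (Metric.ball (p₁ (c x)) ε) Metric.isOpen_ball).symm
  have hp₂t : p₂.target = Metric.ball (p₁ (c x)) ε := Set.inter_eq_right.2 hball
  have hp₂s : p₂.source ⊆ p₁.source := by
    intro a ha
    have : a ∈ p₁.symm.target := by
      have := p₂.map_source ha
      rw [← p₂.left_inv ha]
      exact p₁.map_target (show p₂ a ∈ p₁.target from this.1)
    exact this
  have hp₂x : c x ∈ p₂.source := by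
    have h1 : p₁ (c x) ∈ p₂.target := by rw [hp₂t]; exact Metric.mem_ball_self hε
    have := p₂.map_target h1
    rwa [show p₂.symm (p₁ (c x)) = c x from p₁.left_inv hp₁] at this
  have hp₂T : p₂.source ⊆ T' := fun a ha ↦ (hp₂s ha).2
  have hsymm : ContDiffOn ℝ ∞ p₂.symm p₂.target := by
    intro b hb
    obtain ⟨e', he'⟩ := (hp₂T (p₂.map_target hb)).2
    refine (p₂.contDiffAt_symm (f₀' := e') hb ?_ ?_).contDiffWithinAt
    · rw [he']
      exact ((hHa (hp₂T (p₂.map_target hb)).1).differentiableAt (by simp)).hasFDerivAt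
    · exact hHa (hp₂T (p₂.map_target hb)).1
  let z := c.trans p₂
  have hzt : z.target = p₂.target := by
    rw [OpenPartialHomeomorph.trans_target, Set.inter_eq_left]
    exact fun b hb ↦ (hp₂T (p₂.map_target hb)).1.1
  have hzU : z.source ⊆ U := by
    rintro y ⟨hy, hy'⟩
    have : c.symm (c y) ∈ U := (hp₂T hy').1.2
    rwa [c.left_inv hy] at this
  have hzh : Set.EqOn z h z.source := by
    rintro y ⟨hy, hy'⟩
    exact congrArg h (c.left_inv hy)
  refine ⟨z, ⟨mem_chart_source _ x, hp₂x⟩, hzU, hzh, (hh.mono hzU).congr hzh, ?_, ?_⟩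
  · rw [hzt]
    exact (contMDiffOn_chart_symm (I := 𝓡 n)).comp hsymm.contMDiffOn
      fun b hb ↦ (hp₂T (p₂.map_target hb)).1.1
  · rw [hzt, hp₂t]
    exact (convex_ball _ _).isPreconnected

namespace IsSmoothChart

variable {z : OpenPartialHomeomorph M F}

theorem mdifferentiable (hz : IsSmoothChart n z) : z.MDifferentiable (𝓡 n) 𝓘(ℝ, F) :=
  ⟨hz.contMDiffOn.mdifferentiableOn (by simp), hz.contMDiffOn_symm.mdifferentiableOn (by simp)⟩

/-- A function with vanishing derivative is constant on the domain of a smooth chart. -/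
theorem eq_of_mvfderiv_eq_zero (hz : IsSmoothChart n z) {k : M → G}
    (hk : ∀ y ∈ z.source, MDifferentiableAt (𝓡 n) 𝓘(ℝ, G) k y)
    (hk' : ∀ y ∈ z.source, ∀ v, mvfderiv (𝓡 n) k y v = 0) {x y : M} (hx : x ∈ z.source)
    (hy : y ∈ z.source) : k x = k y := by
  have hd {a : F} (ha : a ∈ z.target) :
      HasFDerivAt (k ∘ z.symm) (0 : F →L[ℝ] G) a := by
    have h1 := (hk _ (z.map_target ha)).hasMFDerivAt
    have h2 := ((hz.contMDiffOn_symm.contMDiffAt (z.open_target.mem_nhds ha)).mdifferentiableAt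
      (by simp)).hasMFDerivAt
    have h3 := h1.comp a h2
    rw [show mfderiv (𝓡 n) 𝓘(ℝ, G) k (z.symm a) ∘L mfderiv 𝓘(ℝ, F) (𝓡 n) z.symm a = 0 from
      ContinuousLinearMap.ext fun v ↦ hk' _ (z.map_target ha) _] at h3
    exact hasMFDerivAt_iff_hasFDerivAt.1 h3
  have := z.open_target.is_const_of_fderiv_eq_zero (𝕜 := ℝ) hz.isPreconnected
    (f := k ∘ z.symm) (fun a ha ↦ (hd ha).differentiableAt.differentiableWithinAt)
    (fun a ha ↦ (hd ha).fderiv) (z.map_source hx) (z.map_source hy)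
  simpa [z.left_inv hx, z.left_inv hy] using this

theorem isInvertible_mfderiv (hz : IsSmoothChart n z) {u : M → F} (hzu : Set.EqOn z u z.source)
    {y : M} (hy : y ∈ z.source) : (mfderiv (𝓡 n) 𝓘(ℝ, F) u y).IsInvertible := by
  have h : u =ᶠ[𝓝 y] z :=
    Filter.eventuallyEq_of_mem (z.open_source.mem_nhds hy) fun _ h ↦ (hzu h).symm
  have h' := hz.mdifferentiable.mdifferentiableAt hy |>.hasMFDerivAt.congr_of_eventuallyEq h
  rw [h'.mfderiv]
  exact ⟨hz.mdifferentiable.mfderiv hy, rfl⟩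

end IsSmoothChart

end Coordinates

/-! ### Constancy of the affine normal -/

section ParabolicSphere

variable {n : ℕ} {M : Type*} [TopologicalSpace M] [ChartedSpace (EuclideanSpace ℝ (Fin n)) M]

variable {φ ξ : M → Fin (n + 1) → ℝ}

theorem mdifferentiableAt_of_pi {m : ℕ} {F : Type*} [NormedAddCommGroup F] [NormedSpace ℝ F]
    {R : M → Fin m → F} {x : M}
    (h : ∀ i, MDifferentiableAt (𝓡 n) 𝓘(ℝ, F) (fun y ↦ R y i) x) :
    MDifferentiableAt (𝓡 n) 𝓘(ℝ, Fin m → F) R x := by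
  have h' (i) := (mdifferentiableAt_iff _ _).1 (h i)
  exact (mdifferentiableAt_iff _ _).2 ⟨continuousAt_pi.2 fun i ↦ (h' i).1,
    differentiableWithinAt_pi.2 fun i ↦ (h' i).2⟩

/-- The determinant as a continuous multilinear function of the rows. -/
def detMultilinear (m : ℕ) : ContinuousMultilinearMap ℝ (fun _ : Fin m ↦ Fin m → ℝ) ℝ where
  toMultilinearMap := (Matrix.detRowAlternating (n := Fin m) (R := ℝ)).toMultilinearMap
  cont := Continuous.matrix_det (A := fun X : Fin m → Fin m → ℝ ↦ Matrix.of X) continuous_id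

theorem inducedVolume_eq_detMultilinear (φ ξ : M → Fin (n + 1) → ℝ) (x : M)
    (w : Fin n → TangentSpace (𝓡 n) x) : inducedVolume φ ξ x w =
      detMultilinear (n + 1) (Fin.cons (ξ x) fun i ↦ mvfderiv (𝓡 n) φ x (w i)) := rfl

theorem inducedVolume_ne_zero (h : IsTransversalImmersion φ ξ) {x : M}
    {w : Fin n → TangentSpace (𝓡 n) x} (hw : LinearIndependent ℝ w) :
    inducedVolume φ ξ x w ≠ 0 := by
  have h1 : LinearIndependent ℝ (fun i ↦ mvfderiv (𝓡 n) φ x (w i)) :=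
    hw.map' (mvfderiv (𝓡 n) φ x).toLinearMap (LinearMap.ker_eq_bot.2 (h.injective_mvfderiv x))
  have h2 : LinearIndependent ℝ (Fin.cons (ξ x) (fun i ↦ mvfderiv (𝓡 n) φ x (w i)) :
      Fin (n + 1) → Fin (n + 1) → ℝ) := by
    rw [linearIndependent_finCons]
    refine ⟨h1, fun hx ↦ h.transversal x ?_⟩
    have : Submodule.span ℝ (Set.range fun i ↦ mvfderiv (𝓡 n) φ x (w i)) ≤
        LinearMap.range (mvfderiv (𝓡 n) φ x).toLinearMap :=
      Submodule.span_le.2 (by rintro _ ⟨i, rfl⟩; exact ⟨w i, rfl⟩)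
    exact this hx
  exact ((Matrix.isUnit_iff_isUnit_det _).1
    (Matrix.linearIndependent_rows_iff_isUnit.1 h2)).ne_zero

variable [IsManifold (𝓡 n) ∞ M] {D : AffineConnection n M} {g : PseudoRiemannianMetric n M}

/-- The affine normal of a parabolic affine sphere has vanishing derivative. -/
theorem IsParabolicSphere.mvfderiv_field (h : IsParabolicSphere φ ξ D g) (x : M)
    (v : TangentSpace (𝓡 n) x) : mvfderiv (𝓡 n) ξ x v = 0 := by
  obtain ⟨τ, hτ⟩ := h.shape
  have hI := h.blaschke.transversal_immersion
  have hξ : mvfderiv (𝓡 n) ξ x v = τ x v • ξ x := by simpa using hτ x v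
  let b := (EuclideanSpace.basisFun (Fin n) ℝ).toBasis
  let Y (i : Fin n) : Π x : M, TangentSpace (𝓡 n) x :=
    FiberBundle.extend (x := x) (EuclideanSpace ℝ (Fin n)) (b i : TangentSpace (𝓡 n) x)
  have hYx (i : Fin n) : Y i x = b i := FiberBundle.extend_apply_self _ _
  have hY (i : Fin n) : DiffFieldAt (Y i) x := FiberBundle.mdifferentiableAt_extend _ _ _
  have hne : inducedVolume φ ξ x (fun i ↦ Y i x) ≠ 0 := by
    refine inducedVolume_ne_zero hI ?_
    rw [funext hYx]
    exact b.linearIndependent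
  let R : M → Fin (n + 1) → Fin (n + 1) → ℝ :=
    fun y ↦ Fin.cons (ξ y) fun i ↦ mvfderiv (𝓡 n) φ y (Y i y)
  have hR : MDifferentiableAt (𝓡 n) 𝓘(ℝ, Fin (n + 1) → Fin (n + 1) → ℝ) R x := by
    refine mdifferentiableAt_of_pi (Fin.cases ?_ fun i ↦ ?_)
    · exact hI.contMDiff_field.contMDiffAt.mdifferentiableAt (by simp)
    · exact mdifferentiableAt_mvfderiv_apply hI.contMDiff (hY i)
  have hRi (i : Fin (n + 1)) : mvfderiv (𝓡 n) R x v i = mvfderiv (𝓡 n) (fun y ↦ R y i) x v :=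
    (mvfderiv_clm_comp (ContinuousLinearMap.proj (R := ℝ) (φ := fun _ ↦ Fin (n + 1) → ℝ) i)
      hR v).symm
  have hR0 : mvfderiv (𝓡 n) R x v 0 = τ x v • ξ x := (hRi 0).trans hξ
  have hRs (i : Fin n) : mvfderiv (𝓡 n) R x v i.succ
      = mvfderiv (𝓡 n) φ x (D (Y i) x v) + g.val x v (Y i x) • ξ x :=
    (hRi i.succ).trans (h.blaschke.gauss x v (Y i) (hY i))
  have hd := h.blaschke.parallel_volume x v Y hY
  simp only [inducedVolume_eq_detMultilinear] at hd
  have hd' := mvfderiv_comp_eq_fderiv (f := R)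
    ((detMultilinear (n + 1)).hasFDerivAt (R x)).differentiableAt hR v
  -- The determinant is differentiated row by row. The row of `ξ` contributes `τ(v) θ`. In every
  -- other row the `ξ` component given by the Gauss formula repeats the row of `ξ`, so only `∇_v Yᵢ`
  -- survives. Parallelism of `θ` cancels these terms and leaves `τ(v) θ = 0`, where `θ ≠ 0` on the
  -- chosen frame.
  rw [((detMultilinear (n + 1)).hasFDerivAt (R x)).fderiv,
    ContinuousMultilinearMap.linearDeriv_apply, Fin.sum_univ_succ, hd, hR0] at hd'
  have h0 : detMultilinear (n + 1) (Function.update (R x) 0 (τ x v • ξ x))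
      = τ x v * inducedVolume φ ξ x (fun i ↦ Y i x) := by
    rw [ContinuousMultilinearMap.map_update_smul, inducedVolume_eq_detMultilinear, smul_eq_mul]
    congr 2
    exact Function.update_eq_self 0 (R x)
  have hs (i : Fin n) :
      detMultilinear (n + 1) (Function.update (R x) i.succ (mvfderiv (𝓡 n) R x v i.succ))
      = detMultilinear (n + 1) (Fin.cons (ξ x) fun j ↦ mvfderiv (𝓡 n) φ x
          (Function.update (fun j ↦ Y j x) i (D (Y i) x v) j)) := by
    rw [hRs, ContinuousMultilinearMap.map_update_add, ContinuousMultilinearMap.map_update_smul]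
    have hz : detMultilinear (n + 1) (Function.update (R x) i.succ (ξ x)) = 0 := by
      refine (Matrix.detRowAlternating (n := Fin (n + 1)) (R := ℝ)).map_eq_zero_of_eq _
        (i := 0) (j := i.succ) ?_ (Fin.succ_ne_zero i).symm
      rw [Function.update_self, Function.update_of_ne (Fin.succ_ne_zero i).symm]
      rfl
    rw [hz, smul_zero, add_zero]
    congr 1
    simp only [R]
    rw [← Fin.cons_update]
    congr 1
    ext j : 1
    by_cases hj : j = i
    · subst hj; simp
    · simp [Function.update_of_ne hj]
  rw [h0, Finset.sum_congr rfl fun i _ ↦ hs i, right_eq_add, mul_eq_zero, or_iff_left hne] at hd'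
  rw [hξ, hd', zero_smul]

end ParabolicSphere

/-! ### Flat coordinates of a parabolic affine sphere -/

/-- The map `(v, t) ↦ A v + t c` is injective; `p` and `l` are the components of a left inverse.
With `A = dφ` and `c = ξ` they produce the affine coordinates and the potential. -/
theorem exists_retraction_and_functional {V W : Type*} [NormedAddCommGroup V] [NormedSpace ℝ V]
    [NormedAddCommGroup W] [NormedSpace ℝ W] [FiniteDimensional ℝ W] (A : V →L[ℝ] W)
    (hA : Function.Injective A) {c : W} (hc : c ∉ Set.range A) :
    ∃ (p : W →L[ℝ] V) (l : W →L[ℝ] ℝ), (∀ v, p (A v) = v) ∧ p c = 0 ∧ l c = 1 := by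
  let B : V × ℝ →ₗ[ℝ] W := A.toLinearMap.coprod (LinearMap.toSpanSingleton ℝ W c)
  have hB (v : V) (t : ℝ) : B (v, t) = A v + t • c := by simp [B]
  have hinj : LinearMap.ker B = ⊥ := by
    refine LinearMap.ker_eq_bot'.2 ?_
    rintro ⟨v, t⟩ h
    rw [hB] at h
    have ht : t = 0 := by
      by_contra ht
      refine hc ⟨-(t⁻¹ • v), ?_⟩
      rw [map_neg, map_smul, eq_neg_of_add_eq_zero_left h, smul_neg, smul_smul,
        inv_mul_cancel₀ ht, one_smul, neg_neg]
    subst ht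
    rw [zero_smul, add_zero] at h
    rw [hA (h.trans (map_zero A).symm)]
    rfl
  obtain ⟨C, hC⟩ := B.exists_leftInverse_of_injective hinj
  have hC' (v : V) (t : ℝ) : C (A v + t • c) = (v, t) := by
    rw [← hB]; exact LinearMap.congr_fun hC (v, t)
  have h1 := hC' 0 1
  rw [map_zero, zero_add, one_smul] at h1
  refine ⟨(LinearMap.fst ℝ V ℝ ∘ₗ C).toContinuousLinearMap,
    (LinearMap.snd ℝ V ℝ ∘ₗ C).toContinuousLinearMap, fun v ↦ ?_, ?_, ?_⟩
  · have := hC' v 0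
    rw [zero_smul, add_zero] at this
    exact congrArg Prod.fst this
  · exact congrArg Prod.fst h1
  · exact congrArg Prod.snd h1

section FlatChart

variable {n : ℕ} {M : Type*} [TopologicalSpace M] [ChartedSpace (EuclideanSpace ℝ (Fin n)) M]
  [IsManifold (𝓡 n) ∞ M]

/-- Local coordinates `u`, defined on the source of `z`, which are affine with respect to the
connection `D`, together with a local potential `f` of `g`, i.e. `g = ∇ df`. -/
structure IsFlatChart (D : AffineConnection n M) (g : PseudoRiemannianMetric n M)
    (u : M → EuclideanSpace ℝ (Fin n)) (f : M → ℝ)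
    (z : OpenPartialHomeomorph M (EuclideanSpace ℝ (Fin n))) : Prop where
  contMDiff : ContMDiff (𝓡 n) (𝓡 n) ∞ u
  contMDiff_potential : ContMDiff (𝓡 n) 𝓘(ℝ, ℝ) ∞ f
  eqOn : Set.EqOn z u z.source
  isSmoothChart : IsSmoothChart n z
  mvfderiv_mvfderiv : ∀ y ∈ z.source, ∀ (v : TangentSpace (𝓡 n) y)
    (Y : Π x : M, TangentSpace (𝓡 n) x), DiffFieldAt Y y →
    mvfderiv (𝓡 n) (fun x ↦ mvfderiv (𝓡 n) u x (Y x)) y v = mvfderiv (𝓡 n) u y (D Y y v)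
  mvfderiv_mvfderiv_potential : ∀ y ∈ z.source, ∀ (v : TangentSpace (𝓡 n) y)
    (Y : Π x : M, TangentSpace (𝓡 n) x), DiffFieldAt Y y →
    mvfderiv (𝓡 n) (fun x ↦ mvfderiv (𝓡 n) f x (Y x)) y v
      = mvfderiv (𝓡 n) f y (D Y y v) + g.val y v (Y y)

variable {D : AffineConnection n M} {g : PseudoRiemannianMetric n M}

/-- A linear map `q` applied to the Gauss formula gives the second derivative of `q ∘ φ` as `d(q ∘
φ)(∇_v Y) + g(v, Y) q(ξ)`. Since `ξ` is constant on the chart, the choices `q(ξ) = 0` and `q(ξ) = 1`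
give `u` and `f`. -/
theorem IsParabolicSphere.exists_isFlatChart {φ ξ : M → Fin (n + 1) → ℝ}
    (h : IsParabolicSphere φ ξ D g) (x₀ : M) :
    ∃ (u : M → EuclideanSpace ℝ (Fin n)) (f : M → ℝ)
      (z : OpenPartialHomeomorph M (EuclideanSpace ℝ (Fin n))), x₀ ∈ z.source ∧
      IsFlatChart D g u f z ∧ ∀ v : EuclideanSpace ℝ (Fin n), mvfderiv (𝓡 n) u x₀ v = v := by
  have hI := h.blaschke.transversal_immersion
  obtain ⟨p, l, hp, hpc, hlc⟩ := exists_retraction_and_functional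
    (V := EuclideanSpace ℝ (Fin n)) (mvfderiv (𝓡 n) φ x₀)
    (hI.injective_mvfderiv x₀) (hI.transversal x₀)
  have hφ (y : M) : MDifferentiableAt (𝓡 n) 𝓘(ℝ, Fin (n + 1) → ℝ) φ y :=
    hI.contMDiff.contMDiffAt.mdifferentiableAt (by simp)
  have hu : ContMDiff (𝓡 n) (𝓡 n) ∞ (fun y ↦ p (φ y)) := p.contMDiff.comp hI.contMDiff
  have hdu : ∀ v : EuclideanSpace ℝ (Fin n), mvfderiv (𝓡 n) (fun y ↦ p (φ y)) x₀ v = v :=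
    fun v ↦ (mvfderiv_clm_comp p (hφ x₀) v).trans (hp v)
  obtain ⟨z, hz, -, hzu, hzs⟩ := exists_isSmoothChart isOpen_univ (Set.mem_univ x₀)
    hu.contMDiffOn (.refl ℝ _) hdu
  have hξ {y : M} (hy : y ∈ z.source) : ξ y = ξ x₀ :=
    hzs.eq_of_mvfderiv_eq_zero
      (fun y _ ↦ hI.contMDiff_field.contMDiffAt.mdifferentiableAt (by simp))
      (fun y _ v ↦ h.mvfderiv_field y v) hy hz
  have key {F : Type _} [NormedAddCommGroup F] [NormedSpace ℝ F] (q : (Fin (n + 1) → ℝ) →L[ℝ] F)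
      {y : M} (hy : y ∈ z.source) (v : TangentSpace (𝓡 n) y)
      (Y : Π x : M, TangentSpace (𝓡 n) x) (hY : DiffFieldAt Y y) :
      mvfderiv (𝓡 n) (fun x ↦ mvfderiv (𝓡 n) (fun y ↦ q (φ y)) x (Y x)) y v
        = mvfderiv (𝓡 n) (fun y ↦ q (φ y)) y (D Y y v) + g.val y v (Y y) • q (ξ x₀) := by
    simp only [mvfderiv_clm_comp q (hφ _)]
    rw [mvfderiv_clm_comp q (mdifferentiableAt_mvfderiv_apply hI.contMDiff hY),
      h.blaschke.gauss y v Y hY, map_add, map_smul, hξ hy]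
  refine ⟨fun y ↦ p (φ y), fun y ↦ l (φ y), z, hz,
    ⟨hu, l.contMDiff.comp hI.contMDiff, hzu, hzs, fun y hy v Y hY ↦ ?_, fun y hy v Y hY ↦ ?_⟩, hdu⟩
  · rw [key p hy v Y hY, hpc, smul_zero, add_zero]
  · rw [key l hy v Y hY, hlc, smul_eq_mul, mul_one]

end FlatChart

/-! ### Parallel coordinate fields and the primitive of `du ∘ J` -/

section FlatFields

variable {n : ℕ} {M : Type*} [TopologicalSpace M] [ChartedSpace (EuclideanSpace ℝ (Fin n)) M]
  [IsManifold (𝓡 n) ∞ M]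

theorem AlmostComplexStructure.diffFieldAt_apply (J : AlmostComplexStructure n M) {x : M}
    {Y : Π x : M, TangentSpace (𝓡 n) x} (hY : DiffFieldAt Y x) :
    DiffFieldAt (fun y ↦ J.val y (Y y)) x :=
  (J.contMDiff.contMDiffAt.mdifferentiableAt (by simp)).clm_bundle_apply hY

theorem PseudoRiemannianMetric.mdifferentiableAt_apply (g : PseudoRiemannianMetric n M) {x : M}
    {Y Z : Π x : M, TangentSpace (𝓡 n) x} (hY : DiffFieldAt Y x) (hZ : DiffFieldAt Z x) :
    MDifferentiableAt (𝓡 n) 𝓘(ℝ, ℝ) (fun y ↦ g.val y (Y y) (Z y)) x := by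
  have : MDifferentiableAt (𝓡 n) ((𝓡 n).prod 𝓘(ℝ))
      (fun m ↦ TotalSpace.mk' ℝ (E := Bundle.Trivial M ℝ) m (g.val m (Y m) (Z m))) x := by
    apply MDifferentiableAt.clm_bundle_apply₂ (F₁ := EuclideanSpace ℝ (Fin n))
      (F₂ := EuclideanSpace ℝ (Fin n))
    · exact g.contMDiff.contMDiffAt.mdifferentiableAt (by simp)
    · exact hY
    · exact hZ
  simp only [mdifferentiableAt_totalSpace] at this
  exact this.2

/-- The vector field whose components in the coordinates `u` are constant, equal to `w`. -/
def coordField (u : M → EuclideanSpace ℝ (Fin n)) (w : EuclideanSpace ℝ (Fin n)) :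
    Π x : M, TangentSpace (𝓡 n) x :=
  mpullback (𝓡 n) (𝓡 n) u (fun _ ↦ w)

namespace IsFlatChart

variable {D : AffineConnection n M} {g : PseudoRiemannianMetric n M}
  {u : M → EuclideanSpace ℝ (Fin n)} {f : M → ℝ}
  {z : OpenPartialHomeomorph M (EuclideanSpace ℝ (Fin n))}

theorem mvfderiv_injective (hu : IsFlatChart D g u f z) {y : M} (hy : y ∈ z.source) :
    Function.Injective (mvfderiv (𝓡 n) u y) :=
  (hu.isSmoothChart.isInvertible_mfderiv hu.eqOn hy).injective

theorem mvfderiv_coordField (hu : IsFlatChart D g u f z) {y : M} (hy : y ∈ z.source)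
    (w : EuclideanSpace ℝ (Fin n)) : mvfderiv (𝓡 n) u y (coordField u w y) = w :=
  (hu.isSmoothChart.isInvertible_mfderiv hu.eqOn hy).self_apply_inverse _

theorem coordField_mvfderiv (hu : IsFlatChart D g u f z) {y : M} (hy : y ∈ z.source)
    (v : TangentSpace (𝓡 n) y) : coordField u (mvfderiv (𝓡 n) u y v) y = v :=
  hu.mvfderiv_injective hy (hu.mvfderiv_coordField hy _)

theorem contMDiffAt_coordField (hu : IsFlatChart D g u f z) {y : M} (hy : y ∈ z.source)
    (w : EuclideanSpace ℝ (Fin n)) : ContMDiffAt (𝓡 n) (𝓡 n).tangent ∞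
      (fun x ↦ (⟨x, coordField u w x⟩ : TangentBundle (𝓡 n) M)) y := by
  refine ContMDiffAt.mpullback_vectorField_preimage (n := ∞) ?_ hu.contMDiff.contMDiffAt
    (hu.isSmoothChart.isInvertible_mfderiv hu.eqOn hy) (by simp)
  exact contMDiffAt_vectorSpace_iff_contDiffAt.2 contDiffAt_const

theorem diffFieldAt_coordField (hu : IsFlatChart D g u f z) {y : M} (hy : y ∈ z.source)
    (w : EuclideanSpace ℝ (Fin n)) : DiffFieldAt (coordField u w) y :=
  (hu.contMDiffAt_coordField hy w).mdifferentiableAt (by simp)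

theorem connection_coordField (hu : IsFlatChart D g u f z) {y : M} (hy : y ∈ z.source)
    (w : EuclideanSpace ℝ (Fin n)) (v : TangentSpace (𝓡 n) y) : D (coordField u w) y v = 0 := by
  apply hu.mvfderiv_injective hy
  rw [map_zero, ← hu.mvfderiv_mvfderiv y hy v _ (hu.diffFieldAt_coordField hy w),
    mvfderiv_congr (f' := fun _ ↦ w), mvfderiv_fun_const]
  filter_upwards [z.open_source.mem_nhds hy] with x hx
  exact hu.mvfderiv_coordField hx w

/-- A parallel two-form has constant components in affine coordinates. -/
theorem apply_coordField_eq (hu : IsFlatChart D g u f z) {J : AlmostComplexStructure n M}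
    (hJ : IsParallelBilin D (fun x v w ↦ g.val x (J.val x v) w)) (a b : EuclideanSpace ℝ (Fin n))
    {x y : M} (hx : x ∈ z.source) (hy : y ∈ z.source) :
    g.val x (J.val x (coordField u a x)) (coordField u b x)
      = g.val y (J.val y (coordField u a y)) (coordField u b y) := by
  refine hu.isSmoothChart.eq_of_mvfderiv_eq_zero
    (k := fun x ↦ g.val x (J.val x (coordField u a x)) (coordField u b x))
    (fun y hy ↦ g.mdifferentiableAt_apply (J.diffFieldAt_apply (hu.diffFieldAt_coordField hy a))
      (hu.diffFieldAt_coordField hy b)) (fun y hy v ↦ ?_) hx hy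
  rw [hJ y v _ _ (hu.diffFieldAt_coordField hy a) (hu.diffFieldAt_coordField hy b),
    hu.connection_coordField hy, hu.connection_coordField hy]
  simp

/-- If `g(J ·, ·)` is parallel, the one-form `du ∘ J` has a local primitive: the image of the
gradient of the potential of `g` under a linear map. -/
theorem exists_primitive (hu : IsFlatChart D g u f z) {J : AlmostComplexStructure n M}
    (hJ : IsParallelBilin D (fun x v w ↦ g.val x (J.val x v) w)) {x₀ : M} (hx₀ : x₀ ∈ z.source) :
    ∃ q : M → EuclideanSpace ℝ (Fin n), ContMDiffOn (𝓡 n) (𝓡 n) ∞ q z.source ∧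
      ∀ y ∈ z.source, ∀ v : TangentSpace (𝓡 n) y,
        mvfderiv (𝓡 n) q y v = mvfderiv (𝓡 n) u y (J.val y v) := by
  let E := EuclideanSpace ℝ (Fin n)
  let e : Module.Basis (Fin n) ℝ E := (EuclideanSpace.basisFun (Fin n) ℝ).toBasis
  let C : E →L[ℝ] TangentSpace (𝓡 n) x₀ := (mfderiv (𝓡 n) (𝓡 n) u x₀).inverse
  have hC (w : E) : coordField u w x₀ = C w := rfl
  -- The matrix of `ω = g(J·, ·)` in the coordinates `u`. It is taken at `x₀`, but by
  -- `apply_coordField_eq` it is the same at every point of the chart.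
  let B : E →ₗ[ℝ] Fin n → ℝ := LinearMap.pi fun i ↦
    (g.val x₀ (coordField u (e i) x₀) ∘L J.val x₀ ∘L C).toLinearMap
  have hB {y : M} (hy : y ∈ z.source) (a : E) (i : Fin n) :
      B a i = g.val y (J.val y (coordField u a y)) (coordField u (e i) y) :=
    (g.symm x₀ _ _).trans (hu.apply_coordField_eq hJ a (e i) hx₀ hy)
  have hBinj : Function.Injective B := by
    refine (injective_iff_map_eq_zero B).2 fun a ha ↦ ?_
    have h1 : (g.val x₀ (J.val x₀ (C a)) ∘L C).toLinearMap = 0 :=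
      e.ext fun i ↦ (g.symm x₀ _ _).trans (congrFun ha i)
    have h2 : J.val x₀ (C a) = 0 := by
      refine g.nondegenerate x₀ _ fun w ↦ ?_
      rw [← hu.coordField_mvfderiv hx₀ w]
      exact LinearMap.congr_fun h1 _
    have h3 : C a = 0 := by
      rw [← neg_eq_zero, ← J.sq_eq_neg, h2, map_zero]
    rw [← hu.mvfderiv_coordField hx₀ a, hC, h3, map_zero]
  let Be : E ≃L[ℝ] (Fin n → ℝ) :=
    (B.linearEquivOfInjective hBinj (by simp [E])).toContinuousLinearEquiv
  have hBe (a : E) : Be a = B a := rfl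
  let k : M → Fin n → ℝ := fun y i ↦ mvfderiv (𝓡 n) f y (coordField u (e i) y)
  have hk : ContMDiffOn (𝓡 n) 𝓘(ℝ, Fin n → ℝ) ∞ k z.source :=
    contMDiffOn_pi_space.2 fun i y hy ↦ (contMDiffAt_mvfderiv_apply hu.contMDiff_potential
      (hu.contMDiffAt_coordField hy (e i))).contMDiffWithinAt
  refine ⟨fun y ↦ (-(Be.symm : (Fin n → ℝ) →L[ℝ] E)) (k y),
    (ContinuousLinearMap.contMDiff _).comp_contMDiffOn hk, fun y hy v ↦ ?_⟩
  have hky : MDifferentiableAt (𝓡 n) 𝓘(ℝ, Fin n → ℝ) k y :=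
    (hk.contMDiffAt (z.open_source.mem_nhds hy)).mdifferentiableAt (by simp)
  rw [mvfderiv_clm_comp _ hky]
  -- Because `∂ᵢ` is parallel, `d(∂ᵢf)(v) = g(v, ∂ᵢ)`, which equals `-ω(Jv, ∂ᵢ)` by `J² = -1`. This
  -- is the source of the sign in `q = -Be⁻¹ k`.
  have hdk : mvfderiv (𝓡 n) k y v = -Be (mvfderiv (𝓡 n) u y (J.val y v)) := by
    ext i
    rw [Pi.neg_apply, hBe, hB hy, hu.coordField_mvfderiv hy, J.sq_eq_neg, map_neg,
      neg_apply, neg_neg]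
    have h1 := mvfderiv_clm_comp (ContinuousLinearMap.proj (R := ℝ) (φ := fun _ ↦ ℝ) i) hky v
    have h2 := hu.mvfderiv_mvfderiv_potential y hy v _ (hu.diffFieldAt_coordField hy (e i))
    rw [hu.connection_coordField hy, map_zero, zero_add] at h2
    exact h1.symm.trans h2
  rw [hdk, map_neg, neg_apply, neg_neg]
  exact Be.symm_apply_apply _

end IsFlatChart

end FlatFields

/-! ### Special parabolic spheres are special Kähler -/

/-- Letting `i` act as `J` makes `V` a complex vector space of half the real dimension; `L` is any
complex-linear isomorphism to the standard one. -/
theorem exists_equiv_complex {V : Type*} [NormedAddCommGroup V] [NormedSpace ℝ V]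
    [FiniteDimensional ℝ V] (J : V →L[ℝ] V) (hJ : ∀ v, J (J v) = -v) :
    ∃ L : V ≃L[ℝ] EuclideanSpace ℂ (Fin (Module.finrank ℝ V / 2)),
      ∀ v, L (J v) = Complex.I • L v := by
  have hJ' : J.toLinearMap * J.toLinearMap = -1 := LinearMap.ext fun v ↦ (hJ v).trans (by simp)
  let ρ : ℂ →ₐ[ℝ] Module.End ℝ V := Complex.liftAux J.toLinearMap hJ'
  have hρ : ρ Complex.I = J.toLinearMap := Complex.liftAux_apply_I _ hJ'
  let : Module ℂ V := Module.compHom V ρ.toRingHom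
  have hI (v : V) : Complex.I • v = J v := LinearMap.congr_fun hρ v
  have : IsScalarTower ℝ ℂ V := ⟨fun r c v ↦ by
    change ρ (r • c) v = r • ρ c v
    rw [map_smul]; rfl⟩
  have : FiniteDimensional ℂ V := Module.Finite.of_restrictScalars_finite ℝ ℂ V
  have hd : Module.finrank ℂ V
      = Module.finrank ℂ (EuclideanSpace ℂ (Fin (Module.finrank ℝ V / 2))) := by
    rw [finrank_euclideanSpace_fin, ← Module.finrank_mul_finrank ℝ ℂ V,
      Complex.finrank_real_complex, Nat.mul_div_cancel_left _ two_pos]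
  let L := LinearEquiv.ofFinrankEq V (EuclideanSpace ℂ (Fin (Module.finrank ℝ V / 2))) hd
  refine ⟨(L.restrictScalars ℝ).toContinuousLinearEquiv, fun v ↦ ?_⟩
  change L (J v) = Complex.I • L v
  rw [← hI, map_smul]

section SpecialKahler

variable {n : ℕ} {M : Type*} [TopologicalSpace M] [ChartedSpace (EuclideanSpace ℝ (Fin n)) M]
  [IsManifold (𝓡 n) ∞ M] {D : AffineConnection n M} {g : PseudoRiemannianMetric n M}
  {φ ξ : M → Fin (n + 1) → ℝ}

theorem torsion_eq_zero_iff_mlieBracket : D.torsion = 0 ↔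
    ∀ (x : M) (X Y : Π x : M, TangentSpace (𝓡 n) x), DiffFieldAt X x → DiffFieldAt Y x →
      D Y x (X x) - D X x (Y x) = mlieBracket (𝓡 n) X Y x :=
  D.torsion_eq_zero_iff.trans ⟨fun h _ _ _ hX hY ↦ h hX hY, fun h _ _ _ hX hY ↦ h _ _ _ hX hY⟩

/-- Under the injective map `du`, `∇_X Y - ∇_Y X` becomes the commutator of `X` and `Y` acting on
`u`, which is `du([X, Y])`. -/
theorem IsParabolicSphere.torsion_eq_zero (h : IsParabolicSphere φ ξ D g) : D.torsion = 0 := by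
  refine torsion_eq_zero_iff_mlieBracket.2 fun x X Y hX hY ↦ ?_
  obtain ⟨u, f, z, hx, hu, -⟩ := h.exists_isFlatChart x
  apply hu.mvfderiv_injective hx
  rw [mvfderiv_apply_mlieBracket hu.contMDiff.contMDiffAt hX hY, map_sub,
    hu.mvfderiv_mvfderiv x hx _ _ hY, hu.mvfderiv_mvfderiv x hx _ _ hX]

theorem diffFieldAt_connection [CovariantDerivative.ContMDiffCovariantDerivative D ∞]
    {Y Z : Π x : M, TangentSpace (𝓡 n) x} (hY : IsSmoothField Y) (hZ : IsSmoothField Z) (x : M) :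
    DiffFieldAt (fun y ↦ D Z y (Y y)) x := by
  have h := (CovariantDerivative.ContMDiffCovariantDerivative.contMDiff (cov := D)
    (k := ∞)).contMDiff (σ := Z) (by simpa using hZ.contMDiffOn)
  exact ((h.contMDiffAt Filter.univ_mem).mdifferentiableAt (by simp)).clm_bundle_apply
    (hY.contMDiffAt.mdifferentiableAt (by simp))

/-- With `k = du(Z)`, `du` turns iterated covariant derivatives of `Z` into iterated derivatives of
`k`, so the curvature becomes `XYk - YXk - [X, Y]k = 0`. Smoothness of `∇` makes `∇_Y Z`
differentiable, as the second differentiation requires. -/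
theorem IsParabolicSphere.isFlat [CovariantDerivative.ContMDiffCovariantDerivative D ∞]
    (h : IsParabolicSphere φ ξ D g) : IsFlat D := by
  intro X Y Z hX hY hZ x
  obtain ⟨u, f, z, hx, hu, -⟩ := h.exists_isFlatChart x
  have hd {W : Π x : M, TangentSpace (𝓡 n) x} (hW : IsSmoothField W) (y : M) : DiffFieldAt W y :=
    hW.contMDiffAt.mdifferentiableAt (by simp)
  let k : M → EuclideanSpace ℝ (Fin n) := fun y ↦ mvfderiv (𝓡 n) u y (Z y)
  have hk : ContMDiff (𝓡 n) (𝓡 n) ∞ k :=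
    fun y ↦ contMDiffAt_mvfderiv_apply hu.contMDiff hZ.contMDiffAt
  have hDD {V W : Π x : M, TangentSpace (𝓡 n) x} (hW : IsSmoothField W) :
      mvfderiv (𝓡 n) u x (D (fun y ↦ D Z y (W y)) x (V x))
        = mvfderiv (𝓡 n) (fun y ↦ mvfderiv (𝓡 n) k y (W y)) x (V x) := by
    rw [← hu.mvfderiv_mvfderiv x hx _ _ (diffFieldAt_connection hW hZ x)]
    refine mvfderiv_congr ?_ _
    filter_upwards [z.open_source.mem_nhds hx] with y hy
    exact (hu.mvfderiv_mvfderiv y hy _ _ (hd hZ y)).symm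
  apply hu.mvfderiv_injective hx
  rw [map_sub, map_sub, map_zero, hDD hY, hDD hX, ← hu.mvfderiv_mvfderiv x hx _ _ (hd hZ x),
    mvfderiv_apply_mlieBracket hk.contMDiffAt (hd hX x) (hd hY x), sub_self]

/-- Applying `du` turns `∇_X(JY)` into the derivative of `dq(Y)` along `X`. Without torsion the
remaining terms combine to `dq([X, Y])`, so the expression is `ddq(X, Y)`. -/
theorem IsFlatChart.covariant_exterior_derivative_eq_zero {u : M → EuclideanSpace ℝ (Fin n)}
    {f : M → ℝ} {z : OpenPartialHomeomorph M (EuclideanSpace ℝ (Fin n))}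
    (hu : IsFlatChart D g u f z) (hD : D.torsion = 0) {J : AlmostComplexStructure n M}
    (hJ : IsParallelBilin D (fun x v w ↦ g.val x (J.val x v) w)) {x : M} (hx : x ∈ z.source)
    {X Y : Π x : M, TangentSpace (𝓡 n) x} (hX : DiffFieldAt X x) (hY : DiffFieldAt Y x) :
    (D (fun y ↦ J.val y (Y y)) x (X x) - J.val x (D Y x (X x)))
      - (D (fun y ↦ J.val y (X y)) x (Y x) - J.val x (D X x (Y x))) = 0 := by
  obtain ⟨q, hq, hqu⟩ := hu.exists_primitive hJ hx
  have hDJ {V W : Π x : M, TangentSpace (𝓡 n) x} (hW : DiffFieldAt W x) :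
      mvfderiv (𝓡 n) u x (D (fun y ↦ J.val y (W y)) x (V x))
        = mvfderiv (𝓡 n) (fun y ↦ mvfderiv (𝓡 n) q y (W y)) x (V x) := by
    rw [← hu.mvfderiv_mvfderiv x hx _ _ (J.diffFieldAt_apply hW)]
    refine mvfderiv_congr ?_ _
    filter_upwards [z.open_source.mem_nhds hx] with y hy
    exact (hqu y hy _).symm
  have hb := mvfderiv_apply_mlieBracket (hq.contMDiffAt (z.open_source.mem_nhds hx)) hX hY
  rw [← torsion_eq_zero_iff_mlieBracket.1 hD x X Y hX hY, hqu x hx, map_sub, map_sub] at hb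
  apply hu.mvfderiv_injective hx
  rw [map_sub, map_sub, map_sub, map_zero, hDJ hX, hDJ hY, sub_sub_sub_comm, ← hb, sub_self]

theorem IsParabolicSphere.isCovariantlyClosed (h : IsParabolicSphere φ ξ D g)
    {J : AlmostComplexStructure n M}
    (hJ : IsParallelBilin D (fun x v w ↦ g.val x (J.val x v) w)) : IsCovariantlyClosed D J := by
  intro x X Y hX hY
  obtain ⟨u, f, z, hx, hu, -⟩ := h.exists_isFlatChart x
  exact hu.covariant_exterior_derivative_eq_zero h.torsion_eq_zero hJ hx hX hY

/-- Integrability of `J`: the holomorphic coordinates are `u - J ∘ q`, where `dq = du ∘ J`. -/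
theorem IsParabolicSphere.isComplexStructure (h : IsParabolicSphere φ ξ D g)
    {J : AlmostComplexStructure n M}
    (hJ : IsParallelBilin D (fun x v w ↦ g.val x (J.val x v) w)) : IsComplexStructure J := by
  let E := EuclideanSpace ℝ (Fin n)
  refine ⟨Module.finrank ℝ E / 2, fun x₀ ↦ ?_⟩
  obtain ⟨u, f, z, hx₀, hu, hu₀⟩ := h.exists_isFlatChart x₀
  obtain ⟨q, hq, hqu⟩ := hu.exists_primitive hJ hx₀
  let J₀ : E →L[ℝ] E := J.val x₀
  have hJ₀ (v : E) : J₀ (J₀ v) = -v := J.sq_eq_neg x₀ v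
  obtain ⟨L, hL⟩ := exists_equiv_complex J₀ hJ₀
  let L' := (L : E →L[ℝ] EuclideanSpace ℂ (Fin (Module.finrank ℝ E / 2)))
  let ζ : M → E := fun y ↦ u y - J₀ (q y)
  have huy (y : M) : MDifferentiableAt (𝓡 n) (𝓡 n) u y :=
    hu.contMDiff.contMDiffAt.mdifferentiableAt (by simp)
  have hqy {y : M} (hy : y ∈ z.source) : MDifferentiableAt (𝓡 n) (𝓡 n) q y :=
    (hq.contMDiffAt (z.open_source.mem_nhds hy)).mdifferentiableAt (by simp)
  have hJq : ContMDiffOn (𝓡 n) (𝓡 n) ∞ (fun y ↦ J₀ (q y)) z.source :=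
    J₀.contMDiff.comp_contMDiffOn hq
  have hζ : ContMDiffOn (𝓡 n) (𝓡 n) ∞ ζ z.source := hu.contMDiff.contMDiffOn.sub hJq
  have hdζ {y : M} (hy : y ∈ z.source) (v : TangentSpace (𝓡 n) y) : mvfderiv (𝓡 n) ζ y v
      = mvfderiv (𝓡 n) u y v - J₀ (mvfderiv (𝓡 n) u y (J.val y v)) := by
    rw [← hqu y hy, ← mvfderiv_clm_comp J₀ (hqy hy)]
    have := mvfderiv_fun_sub (huy y)
      ((hJq.contMDiffAt (z.open_source.mem_nhds hy)).mdifferentiableAt (by simp))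
    exact DFunLike.congr_fun this v
  have hζd {y : M} (hy : y ∈ z.source) : MDifferentiableAt (𝓡 n) (𝓡 n) ζ y :=
    (hζ.contMDiffAt (z.open_source.mem_nhds hy)).mdifferentiableAt (by simp)
  -- At `x₀`, `du` is the identity and `dq = J₀`, so `dζ = 1 - J₀² = 2`; hence the factor 2 and the
  -- invertibility.
  have hd₀ (v : E) : mvfderiv (𝓡 n) (fun y ↦ L' (ζ y)) x₀ v
      = ((ContinuousLinearEquiv.smulLeft (Units.mk0 (2 : ℝ) two_ne_zero)).trans L) v := by
    refine ((mvfderiv_clm_comp L' (hζd hx₀) v).trans (congrArg L' (hdζ hx₀ v))).trans ?_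
    change L (mvfderiv (𝓡 n) u x₀ v - J₀ (mvfderiv (𝓡 n) u x₀ (J₀ v))) = L ((2 : ℝ) • v)
    rw [hu₀, hu₀, hJ₀, sub_neg_eq_add, two_smul]
  obtain ⟨Z, hZ₀, hZz, hZζ, hZ⟩ := exists_isSmoothChart z.open_source hx₀
    (L'.contMDiff.comp_contMDiffOn hζ) _ hd₀
  refine ⟨Z, hZ₀, hZ.contMDiffOn, hZ.contMDiffOn_symm, fun y hy v ↦ ?_⟩
  have hyz := hZz hy
  have hc (v : TangentSpace (𝓡 n) y) : mvfderiv (𝓡 n) Z y v = L (mvfderiv (𝓡 n) ζ y v) := by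
    rw [mvfderiv_congr (f' := fun y ↦ L' (ζ y)), mvfderiv_clm_comp L' (hζd hyz)]
    · rfl
    · filter_upwards [Z.open_source.mem_nhds hy] with x hx
      exact hZζ hx
  -- Both `dζ(Jv)` and `J₀ dζ(v)` equal `du(Jv) + J₀ du(v)`.
  rw [hc, hc, ← hL, hdζ hyz, hdζ hyz, J.sq_eq_neg, map_neg, map_neg, sub_neg_eq_add,
    map_sub J₀, hJ₀, sub_neg_eq_add, add_comm]

/-- The Hermitian condition and `J² = -1` give `g(v, Jw) = g(Jv, JJw) = -g(Jv, w)`, and parallelism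
is insensitive to sign. -/
theorem isParallelBilin_kahlerForm_iff {J : AlmostComplexStructure n M} (hJ : IsHermitian g J) :
    IsParallelBilin D (kahlerForm g J)
      ↔ IsParallelBilin D (fun x v w ↦ g.val x (J.val x v) w) := by
  have hk (x : M) (v w : TangentSpace (𝓡 n) x) : kahlerForm g J x v w = -g.val x (J.val x v) w := by
    rw [kahlerForm, ← hJ x v, J.sq_eq_neg, map_neg]
  refine forall_congr' fun x ↦ forall_congr' fun v ↦ forall_congr' fun Y ↦ forall_congr' fun Z ↦
    forall_congr' fun _ ↦ forall_congr' fun _ ↦ ?_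
  simp only [hk]
  rw [mvfderiv_fun_neg, neg_apply, ← neg_add, neg_inj]

/-- A two-form which is parallel for a torsion-free connection is closed. -/
theorem isClosedTwoForm_of_isParallelBilin (hD : D.torsion = 0)
    {Ω : Π x : M, TangentSpace (𝓡 n) x → TangentSpace (𝓡 n) x → ℝ}
    (hΩ : IsParallelBilin D Ω) (hsub : ∀ x v v' w, Ω x (v - v') w = Ω x v w - Ω x v' w)
    (halt : ∀ x v w, Ω x v w = -Ω x w v) : IsClosedTwoForm Ω := by
  intro X Y Z hX hY hZ x
  have hd {W : Π x : M, TangentSpace (𝓡 n) x} (hW : IsSmoothField W) : DiffFieldAt W x :=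
    hW.contMDiffAt.mdifferentiableAt (by simp)
  have hT := torsion_eq_zero_iff_mlieBracket.1 hD x
  -- Derivatives and brackets are both expressed through `∇`; the terms then cancel in pairs by
  -- antisymmetry of `Ω`.
  rw [hΩ x _ Y Z (hd hY) (hd hZ), hΩ x _ X Z (hd hX) (hd hZ), hΩ x _ X Y (hd hX) (hd hY),
    ← hT X Y (hd hX) (hd hY), ← hT X Z (hd hX) (hd hZ), ← hT Y Z (hd hY) (hd hZ),
    hsub, hsub, hsub, halt x (Y x), halt x (X x) (D Z x (Y x)), halt x (X x) (D Y x (Z x))]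
  ring

theorem IsParabolicSphere.isSpecialKahler [CovariantDerivative.ContMDiffCovariantDerivative D ∞]
    (h : IsParabolicSphere φ ξ D g) {J : AlmostComplexStructure n M} (hg : IsHermitian g J)
    (hJ : IsParallelBilin D (fun x v w ↦ g.val x (J.val x v) w)) : IsSpecialKahler D g J := by
  have hk := (isParallelBilin_kahlerForm_iff hg).2 hJ
  refine ⟨⟨h.isComplexStructure hJ, hg, ?_⟩, h.torsion_eq_zero, h.isFlat, hk,
    h.isCovariantlyClosed hJ⟩
  refine isClosedTwoForm_of_isParallelBilin h.torsion_eq_zero hk (fun x v v' w ↦ ?_)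
    (fun x v w ↦ ?_)
  · simp only [kahlerForm, map_sub, sub_apply]
  · rw [kahlerForm, kahlerForm, ← hg x v, J.sq_eq_neg, map_neg, g.symm]

end SpecialKahler

end AffineSphere

end

theorem theorem3p6 {n : ℕ} {M : Type*} [TopologicalSpace M] [T2Space M]
    [ChartedSpace (EuclideanSpace ℝ (Fin n)) M] [IsManifold (𝓡 n) ∞ M]
    (φ ξ : M → Fin (n + 1) → ℝ) (D : AffineSphere.AffineConnection n M)
    [CovariantDerivative.ContMDiffCovariantDerivative D ∞]
    (g : AffineSphere.PseudoRiemannianMetric n M)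
    (h : AffineSphere.IsParabolicSphere φ ξ D g) :
    (∃ J : AffineSphere.AlmostComplexStructure n M, AffineSphere.IsSpecialKahler D g J) ↔
      AffineSphere.IsSpecial D g := by
  constructor
  · rintro ⟨J, hJ⟩
    exact ⟨J, hJ.kahler.hermitian,
      (AffineSphere.isParallelBilin_kahlerForm_iff hJ.kahler.hermitian).1 hJ.parallel⟩
  · rintro ⟨J, hg, hJ⟩
    exact ⟨J, AffineSphere.IsParabolicSphere.isSpecialKahler h hg hJ⟩
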